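/- Let $M$, $\Theta$ and $X$ be compact smooth ($C^\infty$) manifolds without boundary (finite-dimensional and Hausdorff), with $\Theta$ connected, and let $\pi : M \to \Theta$ be a smooth fibre bundle with typical fibre $X$. Let $f : M \to \mathbb{R}$ be smooth. A point $p \in M$ is a fibre-wise critical point of $f$ if it is a critical point of the restriction of $f$ to the fibre $\pi^{-1}(\pi(p))$, and it is non-degenerate if the Hessian of this restriction at $p$ is non-singular. Suppose that $f$ is fibre-wise Morse, i.e. that all its fibre-wise critical points are non-degenerate, and let $N \subset M$ be the set of fibre-wise critical points of $f$. Then the number of points of $N \cap \pi^{-1}(\theta)$ is finite and is the same for all $\theta \in \Theta$. -/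

import Mathlib

open scoped Manifold ContDiff

noncomputable section

section Morse

/-- `x` is a critical point of the function `h` on the manifold `X`: the differential of `h`
vanishes at `x`. -/
def IsCriticalPoint (E : Type*) [NormedAddCommGroup E] [NormedSpace ℝ E]
    {X : Type*} [TopologicalSpace X] [ChartedSpace E X] (h : X → ℝ) (x : X) : Prop :=
  mfderiv 𝓘(ℝ, E) 𝓘(ℝ, ℝ) h x = 0

/-- The Hessian of `h` at `x`, as a bilinear form, read in the preferred chart at `x`.
(At a critical point it is, up to the change of basis, independent of the chart.) -/
def hessianAt (E : Type*) [NormedAddCommGroup E] [NormedSpace ℝ E]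
    {X : Type*} [TopologicalSpace X] [ChartedSpace E X] (h : X → ℝ) (x : X) : E →L[ℝ] E →L[ℝ] ℝ :=
  fderiv ℝ (fderiv ℝ (h ∘ (extChartAt 𝓘(ℝ, E) x).symm)) (extChartAt 𝓘(ℝ, E) x x)

/-- `x` is a critical point of `h` at which the Hessian is non-singular. -/
def IsNondegenerateCriticalPoint (E : Type*) [NormedAddCommGroup E] [NormedSpace ℝ E]
    {X : Type*} [TopologicalSpace X] [ChartedSpace E X] (h : X → ℝ) (x : X) : Prop :=
  IsCriticalPoint E h x ∧ ∀ v : E, (∀ w : E, hessianAt E h x v w = 0) → v = 0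

end Morse

section FibreBundle

/-- A local trivialization `π ⁻¹ U ≃ U × X` of `π : M → Θ` is smooth if it is a diffeomorphism. -/
def IsSmoothTrivialization (EM EB EX : Type*)
    [NormedAddCommGroup EM] [NormedSpace ℝ EM] [NormedAddCommGroup EB] [NormedSpace ℝ EB]
    [NormedAddCommGroup EX] [NormedSpace ℝ EX]
    {M B X : Type*} [TopologicalSpace M] [ChartedSpace EM M] [TopologicalSpace B]
    [ChartedSpace EB B] [TopologicalSpace X] [ChartedSpace EX X]
    {π : M → B} (e : Bundle.Trivialization X π) : Prop :=
  ContMDiffOn 𝓘(ℝ, EM) (𝓘(ℝ, EB).prod 𝓘(ℝ, EX)) ∞ e e.source ∧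
  ContMDiffOn (𝓘(ℝ, EB).prod 𝓘(ℝ, EX)) 𝓘(ℝ, EM) ∞ e.toOpenPartialHomeomorph.symm e.target

/-- `π : M → B` is a smooth fibre bundle with typical fibre `X`. -/
def IsSmoothFibreBundle (EM EB EX : Type*)
    [NormedAddCommGroup EM] [NormedSpace ℝ EM] [NormedAddCommGroup EB] [NormedSpace ℝ EB]
    [NormedAddCommGroup EX] [NormedSpace ℝ EX]
    {M B : Type*} (X : Type*) [TopologicalSpace M] [ChartedSpace EM M] [TopologicalSpace B]
    [ChartedSpace EB B] [TopologicalSpace X] [ChartedSpace EX X] (π : M → B) : Prop :=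
  ContMDiff 𝓘(ℝ, EM) 𝓘(ℝ, EB) ∞ π ∧
  ∀ b : B, ∃ e : Bundle.Trivialization X π, b ∈ e.baseSet ∧ IsSmoothTrivialization EM EB EX e

/-- The restriction of `f` to the fibre over `b`, transported to the typical fibre `X` by the
diffeomorphism `X ≃ π ⁻¹ b` that a local trivialization around `b` provides. -/
def fibreRestriction {M B X : Type*} [TopologicalSpace M] [TopologicalSpace B]
    [TopologicalSpace X] {π : M → B} (e : Bundle.Trivialization X π) (f : M → ℝ) (b : B) : X → ℝ :=
  fun x => f (e.toOpenPartialHomeomorph.symm (b, x))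

/-- `p` is a fibre-wise critical point of `f`: a critical point of the restriction of `f` to the
fibre through `p`. The smooth structure of the fibre is read through a smooth local
trivialization; the notion does not depend on which one. -/
def IsFibrewiseCriticalPoint (EM EB EX : Type*)
    [NormedAddCommGroup EM] [NormedSpace ℝ EM] [NormedAddCommGroup EB] [NormedSpace ℝ EB]
    [NormedAddCommGroup EX] [NormedSpace ℝ EX]
    {M B : Type*} (X : Type*) [TopologicalSpace M] [ChartedSpace EM M] [TopologicalSpace B]
    [ChartedSpace EB B] [TopologicalSpace X] [ChartedSpace EX X]
    (π : M → B) (f : M → ℝ) (p : M) : Prop :=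
  ∃ e : Bundle.Trivialization X π, π p ∈ e.baseSet ∧ IsSmoothTrivialization EM EB EX e ∧
    IsCriticalPoint EX (fibreRestriction e f (π p)) (e p).2

/-- `p` is a non-degenerate fibre-wise critical point of `f`: the restriction of `f` to the fibre
through `p` has a critical point with non-singular Hessian at `p` (again for one, equivalently for
every, smooth local trivialization around `π p`). -/
def IsNondegenerateFibrewiseCriticalPoint (EM EB EX : Type*)
    [NormedAddCommGroup EM] [NormedSpace ℝ EM] [NormedAddCommGroup EB] [NormedSpace ℝ EB]
    [NormedAddCommGroup EX] [NormedSpace ℝ EX]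
    {M B : Type*} (X : Type*) [TopologicalSpace M] [ChartedSpace EM M] [TopologicalSpace B]
    [ChartedSpace EB B] [TopologicalSpace X] [ChartedSpace EX X]
    (π : M → B) (f : M → ℝ) (p : M) : Prop :=
  ∃ e : Bundle.Trivialization X π, π p ∈ e.baseSet ∧ IsSmoothTrivialization EM EB EX e ∧
    IsNondegenerateCriticalPoint EX (fibreRestriction e f (π p)) (e p).2

/-- `f` is a fibre-wise Morse function: all its fibre-wise critical points are non-degenerate. -/
def IsFibrewiseMorse (EM EB EX : Type*)
    [NormedAddCommGroup EM] [NormedSpace ℝ EM] [NormedAddCommGroup EB] [NormedSpace ℝ EB]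
    [NormedAddCommGroup EX] [NormedSpace ℝ EX]
    {M B : Type*} (X : Type*) [TopologicalSpace M] [ChartedSpace EM M] [TopologicalSpace B]
    [ChartedSpace EB B] [TopologicalSpace X] [ChartedSpace EX X] (π : M → B) (f : M → ℝ) : Prop :=
  ∀ p : M, IsFibrewiseCriticalPoint EM EB EX X π f p →
    IsNondegenerateFibrewiseCriticalPoint EM EB EX X π f p

/-- The set `N` of fibre-wise critical points of `f`. -/
def fibrewiseCriticalSet (EM EB EX : Type*)
    [NormedAddCommGroup EM] [NormedSpace ℝ EM] [NormedAddCommGroup EB] [NormedSpace ℝ EB]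
    [NormedAddCommGroup EX] [NormedSpace ℝ EX]
    {M B : Type*} (X : Type*) [TopologicalSpace M] [ChartedSpace EM M] [TopologicalSpace B]
    [ChartedSpace EB B] [TopologicalSpace X] [ChartedSpace EX X]
    (π : M → B) (f : M → ℝ) : Set M :=
  {p | IsFibrewiseCriticalPoint EM EB EX X π f p}

end FibreBundle

end

/-! In a chart adapted to a local trivialization, `f` becomes a function of (u, y), with u in the
base and y in the fibre, and `N` is the zero set of its partial derivative in y (`fibreDeriv`).
Hence `N` is closed, so compact. The y-derivative of `fibreDeriv` is the fibre Hessian, invertible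
at points of `N`, so by the implicit function theorem `N` is locally the graph of a section over Θ
(`exists_local_section`), and π restricted to `N` is a local homeomorphism. From a compact Hausdorff
space to a Hausdorff one, such a map is a covering, possibly with empty fibres; its fibres are
finite, and connectedness of Θ makes their size constant. -/

open Topology Filter Set

/-! ### Coverings and local sections -/

section Covering

/-- A covering map with compact total space onto a preconnected T₁ base has finite fibres,
all of the same cardinality. -/
theorem IsCoveringMap.exists_encard_preimage_singleton_eq {E B : Type*} [TopologicalSpace E]
    [TopologicalSpace B] [CompactSpace E] [T1Space B] [PreconnectedSpace B] {p : E → B}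
    (hp : IsCoveringMap p) : ∃ n : ℕ, ∀ b, (p ⁻¹' {b}).encard = n := by
  have hfin (b : B) : (p ⁻¹' {b}).Finite := by
    have := (hp b).1
    exact (isClosed_singleton.preimage hp.continuous).isCompact.finite ⟨inferInstance⟩
  have hloc : IsLocallyConstant fun b ↦ (p ⁻¹' {b}).encard := by
    rw [IsLocallyConstant.iff_eventually_eq]
    intro b
    obtain ⟨hd, U, hbU, hU, hpU, H, hH⟩ := hp b
    filter_upwards [hU.mem_nhds hbU] with c hc
    -- The trivialization over `U` with model fibre `p ⁻¹' {b}` serves every `c` in `U`.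
    have hcov : IsEvenlyCovered p c (p ⁻¹' {b}) := ⟨hd, U, hc, hU, hpU, H, hH⟩
    exact Set.encard_congr hcov.fiberHomeomorph.toEquiv.symm
  rcases isEmpty_or_nonempty B with h | ⟨⟨b⟩⟩
  · exact ⟨0, fun b ↦ isEmptyElim b⟩
  · obtain ⟨n, hn⟩ := (hfin b).encard_lt_top.ne_top |> ENat.ne_top_iff_exists.mp
    exact ⟨n, fun c ↦ (hloc.apply_eq_of_isPreconnected isPreconnected_univ (mem_univ c)
      (mem_univ b)).trans hn.symm⟩

/-- If a continuous map admits, around every point `p` of a subset `N`, a local section with values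
in `N` that parametrizes `N` near `p`, then its restriction to `N` is a local homeomorphism. -/
theorem isLocalHomeomorph_domRestrict_of_local_section {M B : Type*} [TopologicalSpace M]
    [TopologicalSpace B] {π : M → B} (hπ : Continuous π) {N : Set M}
    (h : ∀ p ∈ N, ∃ g : B → M, Tendsto g (𝓝 (π p)) (𝓝 p) ∧
      (∀ᶠ b in 𝓝 (π p), g b ∈ N ∧ π (g b) = b) ∧ ∀ᶠ q in 𝓝 p, q ∈ N → g (π q) = q) :
    IsLocalHomeomorph (N.domRestrict π) := by
  have hcont : Continuous (N.domRestrict π) := hπ.comp continuous_subtype_val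
  have hopen : IsOpenMap (N.domRestrict π) := by
    rw [isOpenMap_iff_nhds_le]
    rintro ⟨p, hp⟩ s hs
    obtain ⟨g, hg, hsec, -⟩ := h p hp
    rw [Filter.mem_map, nhds_subtype_eq_comap] at hs
    obtain ⟨t, ht, hts⟩ := hs
    -- Every `b` near `π p` is the image of `g b`, which lies in `N` and in `t`.
    filter_upwards [hg ht, hsec] with b hb hb'
    have := @hts ⟨g b, hb'.1⟩ hb
    simpa [Set.domRestrict_apply, hb'.2] using this
  rw [isLocalHomeomorph_iff_isOpenEmbedding_restrict]
  rintro ⟨p, hp⟩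
  obtain ⟨g, -, -, hinj⟩ := h p hp
  obtain ⟨U, hU, hUo, hpU⟩ := eventually_nhds_iff.mp hinj
  have hVo : IsOpen ((↑) ⁻¹' U : Set N) := hUo.preimage continuous_subtype_val
  refine ⟨(↑) ⁻¹' U, hVo.mem_nhds hpU, .of_continuous_injective_isOpenMap
    (hcont.comp continuous_subtype_val) ?_ (hopen.domRestrict hVo)⟩
  rintro ⟨⟨a, ha⟩, haU⟩ ⟨⟨b, hb⟩, hbU⟩ hab
  have hab' : π a = π b := hab
  have : a = b := by rw [← hU a haU ha, ← hU b hbU hb, hab']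
  simp [this]

end Covering

/-! ### Charts adapted to a trivialization -/

section BundleChart

variable {EB EX : Type*} [TopologicalSpace EB] [TopologicalSpace EX]
  {M B X : Type*} [TopologicalSpace M] [TopologicalSpace B] [ChartedSpace EB B]
  [TopologicalSpace X] [ChartedSpace EX X] {π : M → B}

/-- The chart of the total space obtained from a local trivialization and the preferred charts of
the base at `b` and of the typical fibre at `x`. -/
def bundleChart (EB EX : Type*) [TopologicalSpace EB] [TopologicalSpace EX]
    [ChartedSpace EB B] [ChartedSpace EX X] (e : Bundle.Trivialization X π) (b : B) (x : X) :
    OpenPartialHomeomorph M (EB × EX) :=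
  e.toOpenPartialHomeomorph ≫ₕ (chartAt EB b).prod (chartAt EX x)

theorem mem_bundleChart_source {e : Bundle.Trivialization X π} {b : B} {x : X} {q : M} :
    q ∈ (bundleChart EB EX e b x).source ↔ π q ∈ e.baseSet ∧ π q ∈ (chartAt EB b).source ∧
      (e q).2 ∈ (chartAt EX x).source := by
  simp only [bundleChart, OpenPartialHomeomorph.trans_source, mem_inter_iff, mem_preimage,
    OpenPartialHomeomorph.prod_source, mem_prod, e.mem_source, Bundle.Trivialization.coe_coe]
  exact and_congr_right fun h ↦ by rw [e.coe_fst' h]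

theorem bundleChart_apply {e : Bundle.Trivialization X π} {b : B} {x : X} {q : M}
    (hq : π q ∈ e.baseSet) :
    bundleChart EB EX e b x q = (chartAt EB b (π q), chartAt EX x (e q).2) := by
  simp [bundleChart, e.coe_fst' hq]

theorem bundleChart_symm_apply {e : Bundle.Trivialization X π} {b : B} {x : X} (u : EB) (y : EX) :
    (bundleChart EB EX e b x).symm (u, y) =
      e.toOpenPartialHomeomorph.symm ((chartAt EB b).symm u, (chartAt EX x).symm y) := by
  simp [bundleChart]

theorem proj_bundleChart_symm {e : Bundle.Trivialization X π} {b : B} {x : X} {z : EB × EX}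
    (hz : z ∈ (bundleChart EB EX e b x).target) :
    π ((bundleChart EB EX e b x).symm z) = (chartAt EB b).symm z.1 := by
  have h := (bundleChart EB EX e b x).map_target hz
  obtain ⟨h1, h2, -⟩ := mem_bundleChart_source.1 h
  have h3 := (bundleChart EB EX e b x).right_inv hz
  rw [bundleChart_apply h1] at h3
  rw [← h3, (chartAt EB b).left_inv h2, bundleChart_symm_apply]
  simp only [← bundleChart_symm_apply (EB := EB) (EX := EX), h3]

end BundleChart

/-! ### The critical set as zero locus of the fibre derivative -/

section FibreBundle

variable {EM EB EX : Type*}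
  [NormedAddCommGroup EM] [NormedSpace ℝ EM] [NormedAddCommGroup EB] [NormedSpace ℝ EB]
  [NormedAddCommGroup EX] [NormedSpace ℝ EX]
  {M B X : Type*} [TopologicalSpace M] [ChartedSpace EM M]
  [TopologicalSpace B] [ChartedSpace EB B] [TopologicalSpace X] [ChartedSpace EX X]
  {π : M → B}

/-- Being critical along the fibre does not depend on the smooth local trivialization. -/
theorem isCriticalPoint_fibreRestriction_of_isSmoothTrivialization
    {e e' : Bundle.Trivialization X π} (he : IsSmoothTrivialization EM EB EX e)
    (he' : IsSmoothTrivialization EM EB EX e') {f : M → ℝ}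
    (hf : ContMDiff 𝓘(ℝ, EM) 𝓘(ℝ, ℝ) ∞ f) {p : M} (hp : π p ∈ e.baseSet) (hp' : π p ∈ e'.baseSet)
    (h : IsCriticalPoint EX (fibreRestriction e' f (π p)) (e' p).2) :
    IsCriticalPoint EX (fibreRestriction e f (π p)) (e p).2 := by
  have hslice (t : Bundle.Trivialization X π) (ht : IsSmoothTrivialization EM EB EX t)
      (hpt : π p ∈ t.baseSet) :
      ContMDiff 𝓘(ℝ, EX) 𝓘(ℝ, EM) ∞ fun x ↦ t.toOpenPartialHomeomorph.symm (π p, x) := by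
    intro x
    have h1 := ht.2.contMDiffAt (t.open_target.mem_nhds (x := (π p, x)) (t.mem_target.2 hpt))
    exact h1.comp x (contMDiffAt_const.prodMk contMDiffAt_id)
  -- The transition map between the two identifications of the fibre with `X`; the chain rule
  -- carries criticality across it.
  set φ : X → X := fun x ↦ (e' (e.toOpenPartialHomeomorph.symm (π p, x))).2 with hφ
  have hφs : ContMDiff 𝓘(ℝ, EX) 𝓘(ℝ, EX) ∞ φ := by
    intro x
    have hx : e.toOpenPartialHomeomorph.symm (π p, x) ∈ e'.source := by
      rw [e'.mem_source, e.proj_symm_apply' hp]; exact hp'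
    exact ((he'.1.contMDiffAt (e'.open_source.mem_nhds hx)).comp x (hslice e he hp x)).snd
  have hcomp : fibreRestriction e f (π p) = fibreRestriction e' f (π p) ∘ φ := by
    funext x
    have hx : π (e.toOpenPartialHomeomorph.symm (π p, x)) = π p := e.proj_symm_apply' hp
    simp only [fibreRestriction, Function.comp_apply, hφ]
    congr 1
    have h1 := e'.symm_apply_mk_proj (x := e.toOpenPartialHomeomorph.symm (π p, x))
      (by rw [e'.mem_source, hx]; exact hp')
    rw [hx] at h1
    exact h1.symm
  have hφp : φ (e p).2 = (e' p).2 := by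
    simp only [hφ]
    rw [e.symm_apply_mk_proj (e.mem_source.2 hp)]
  have hd : MDifferentiableAt 𝓘(ℝ, EX) 𝓘(ℝ, ℝ) (fibreRestriction e' f (π p)) (φ (e p).2) :=
    ((hf.comp (hslice e' he' hp')) _).mdifferentiableAt (by simp)
  rw [IsCriticalPoint, hcomp, mfderiv_comp _ hd ((hφs _).mdifferentiableAt (by simp))]
  rw [IsCriticalPoint, ← hφp] at h
  rw [h]
  exact ContinuousLinearMap.zero_comp _

/-- The partial derivative along the fibre of `f`, read in `bundleChart`. -/
noncomputable def fibreDeriv (EB EX : Type*) [NormedAddCommGroup EB] [NormedSpace ℝ EB]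
    [NormedAddCommGroup EX] [NormedSpace ℝ EX]
    {M B X : Type*} [TopologicalSpace M] [TopologicalSpace B] [ChartedSpace EB B]
    [TopologicalSpace X] [ChartedSpace EX X] {π : M → B} (e : Bundle.Trivialization X π)
    (f : M → ℝ) (b : B) (x : X) (z : EB × EX) : EX →L[ℝ] ℝ :=
  (fderiv ℝ (f ∘ (bundleChart EB EX e b x).symm) z).comp (.inr ℝ EB EX)

section Smooth

variable [IsManifold 𝓘(ℝ, EB) ∞ B] [IsManifold 𝓘(ℝ, EX) ∞ X]
  {e : Bundle.Trivialization X π} {f : M → ℝ}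

theorem contDiffOn_comp_bundleChart_symm (he : IsSmoothTrivialization EM EB EX e)
    (hf : ContMDiff 𝓘(ℝ, EM) 𝓘(ℝ, ℝ) ∞ f) (b : B) (x : X) :
    ContDiffOn ℝ ∞ (f ∘ (bundleChart EB EX e b x).symm) (bundleChart EB EX e b x).target := by
  intro z hz
  have hz' : z ∈ ((chartAt EB b).prod (chartAt EX x)).target ∧
      ((chartAt EB b).prod (chartAt EX x)).symm z ∈ e.target := by
    simpa [bundleChart, OpenPartialHomeomorph.trans_target] using hz
  have h1 : ContMDiffAt 𝓘(ℝ, EB) 𝓘(ℝ, EB) ∞ (chartAt EB b).symm z.1 :=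
    contMDiffAt_symm_of_mem_maximalAtlas (IsManifold.chart_mem_maximalAtlas b) hz'.1.1
  have h2 : ContMDiffAt 𝓘(ℝ, EX) 𝓘(ℝ, EX) ∞ (chartAt EX x).symm z.2 :=
    contMDiffAt_symm_of_mem_maximalAtlas (IsManifold.chart_mem_maximalAtlas x) hz'.1.2
  have h3 := he.2.contMDiffAt (e.open_target.mem_nhds hz'.2)
  have h4 := (hf _).comp z (h3.comp z ((h1.comp z contDiffAt_fst.contMDiffAt).prodMk
    (h2.comp z contDiffAt_snd.contMDiffAt)))
  exact (contMDiffAt_iff_contDiffAt.1 h4).contDiffWithinAt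

theorem contDiffOn_fibreDeriv (he : IsSmoothTrivialization EM EB EX e)
    (hf : ContMDiff 𝓘(ℝ, EM) 𝓘(ℝ, ℝ) ∞ f) (b : B) (x : X) :
    ContDiffOn ℝ ∞ (fibreDeriv EB EX e f b x) (bundleChart EB EX e b x).target :=
  ((contDiffOn_comp_bundleChart_symm he hf b x).fderiv_of_isOpen
    (bundleChart EB EX e b x).open_target (by simp)).clm_comp contDiffOn_const

/-- In a bundle chart, the derivative of the restriction of `f` to a fibre is the partial
derivative of `f` along the fibre. -/
theorem hasFDerivAt_fibreRestriction_comp_chart_symm (he : IsSmoothTrivialization EM EB EX e)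
    (hf : ContMDiff 𝓘(ℝ, EM) 𝓘(ℝ, ℝ) ∞ f) {b c : B} {x : X} (hc : c ∈ (chartAt EB b).source)
    {y : EX} (hy : (chartAt EB b c, y) ∈ (bundleChart EB EX e b x).target) :
    HasFDerivAt (fibreRestriction e f c ∘ (chartAt EX x).symm)
      (fibreDeriv EB EX e f b x (chartAt EB b c, y)) y := by
  have h1 : HasFDerivAt (f ∘ (bundleChart EB EX e b x).symm) _ (chartAt EB b c, y) :=
    ((contDiffOn_comp_bundleChart_symm he hf b x).contDiffAt
      ((bundleChart EB EX e b x).open_target.mem_nhds hy)).differentiableAt (by simp)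
      |>.hasFDerivAt
  have h2 : HasFDerivAt (fun y : EX ↦ (chartAt EB b c, y)) (.inr ℝ EB EX) y :=
    hasFDerivAt_prodMk_right _ _
  refine (h1.comp y h2).congr_of_eventuallyEq (.of_forall fun y' ↦ ?_)
  simp [fibreRestriction, bundleChart_symm_apply, (chartAt EB b).left_inv hc]

theorem isCriticalPoint_fibreRestriction_iff_fibreDeriv_eq_zero
    (he : IsSmoothTrivialization EM EB EX e)
    (hf : ContMDiff 𝓘(ℝ, EM) 𝓘(ℝ, ℝ) ∞ f) {b : B} {x : X} {q : M}
    (hq : q ∈ (bundleChart EB EX e b x).source) :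
    IsCriticalPoint EX (fibreRestriction e f (π q)) (e q).2 ↔
      fibreDeriv EB EX e f b x (bundleChart EB EX e b x q) = 0 := by
  obtain ⟨hq1, hq2, hq3⟩ := mem_bundleChart_source.1 hq
  have ht := (bundleChart EB EX e b x).map_source hq
  have hd : ContMDiffAt 𝓘(ℝ, EX) 𝓘(ℝ, ℝ) ∞ (fibreRestriction e f (π q)) (e q).2 := by
    have h1 := he.2.contMDiffAt (e.open_target.mem_nhds (x := (π q, (e q).2)) (e.mem_target.2 hq1))
    exact (hf _).comp _ (h1.comp (e q).2 (contMDiffAt_const.prodMk contMDiffAt_id))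
  rw [bundleChart_apply hq1] at ht ⊢
  have hD := hasFDerivAt_fibreRestriction_comp_chart_symm he hf hq2 ht
  have hl := (chartAt EX x).left_inv hq3
  have hc : MDifferentiableAt 𝓘(ℝ, EX) 𝓘(ℝ, EX) (chartAt EX x) (e q).2 :=
    (contMDiffAt_of_mem_maximalAtlas (IsManifold.chart_mem_maximalAtlas (n := ∞) x)
      hq3).mdifferentiableAt (by simp)
  have hcs : MDifferentiableAt 𝓘(ℝ, EX) 𝓘(ℝ, EX) (chartAt EX x).symm (chartAt EX x (e q).2) :=
    (contMDiffAt_symm_of_mem_maximalAtlas (IsManifold.chart_mem_maximalAtlas (n := ∞) x)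
      ((chartAt EX x).map_source hq3)).mdifferentiableAt (by simp)
  rw [← hD.fderiv, ← mfderiv_eq_fderiv, IsCriticalPoint]
  -- Each direction is a chain rule, with the inverse chart and then with the chart.
  constructor
  · intro h
    rw [← hl] at hd h
    rw [mfderiv_comp _ (hd.mdifferentiableAt (by simp)) hcs, h]
    exact ContinuousLinearMap.zero_comp _
  · intro h
    have heq : fibreRestriction e f (π q) =ᶠ[𝓝 (e q).2]
        (fibreRestriction e f (π q) ∘ (chartAt EX x).symm) ∘ chartAt EX x := by
      filter_upwards [(chartAt EX x).open_source.mem_nhds hq3] with y hy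
      simp [(chartAt EX x).left_inv hy]
    rw [heq.mfderiv_eq, mfderiv_comp _ hD.differentiableAt.mdifferentiableAt hc, h]
    exact ContinuousLinearMap.zero_comp _

theorem mem_fibrewiseCriticalSet_iff_fibreDeriv_eq_zero
    (he : IsSmoothTrivialization EM EB EX e)
    (hf : ContMDiff 𝓘(ℝ, EM) 𝓘(ℝ, ℝ) ∞ f) {b : B} {x : X} {q : M}
    (hq : q ∈ (bundleChart EB EX e b x).source) :
    q ∈ fibrewiseCriticalSet EM EB EX X π f ↔
      fibreDeriv EB EX e f b x (bundleChart EB EX e b x q) = 0 := by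
  have hq1 := (mem_bundleChart_source.1 hq).1
  rw [← isCriticalPoint_fibreRestriction_iff_fibreDeriv_eq_zero he hf hq]
  constructor
  · rintro ⟨e', hb, he', h⟩
    exact isCriticalPoint_fibreRestriction_of_isSmoothTrivialization he he' hf hq1 hb h
  · exact fun h ↦ ⟨e, hq1, he, h⟩

/-- Differentiating the slice identity once more in y gives this; the right side is the operator
that the implicit function theorem needs invertible. -/
theorem hessianAt_fibreRestriction (he : IsSmoothTrivialization EM EB EX e)
    (hf : ContMDiff 𝓘(ℝ, EM) 𝓘(ℝ, ℝ) ∞ f) {p : M} (hp : π p ∈ e.baseSet) :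
    hessianAt EX (fibreRestriction e f (π p)) (e p).2 =
      (fderiv ℝ (fibreDeriv EB EX e f (π p) (e p).2)
        (bundleChart EB EX e (π p) (e p).2 p)).comp (.inr ℝ EB EX) := by
  have hps : p ∈ (bundleChart EB EX e (π p) (e p).2).source :=
    mem_bundleChart_source.2 ⟨hp, mem_chart_source _ _, mem_chart_source _ _⟩
  have ht := (bundleChart EB EX e (π p) (e p).2).map_source hps
  have hG := ((contDiffOn_fibreDeriv he hf (π p) (e p).2).contDiffAt
    ((bundleChart EB EX e (π p) (e p).2).open_target.mem_nhds ht)).differentiableAt (by simp)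
      |>.hasFDerivAt
  rw [bundleChart_apply hp] at ht hG ⊢
  have hslice : Continuous fun y : EX ↦ (chartAt EB (π p) (π p), y) := by fun_prop
  have heq : fderiv ℝ (fibreRestriction e f (π p) ∘ (chartAt EX (e p).2).symm)
      =ᶠ[𝓝 (chartAt EX (e p).2 (e p).2)]
      fun y ↦ fibreDeriv EB EX e f (π p) (e p).2 (chartAt EB (π p) (π p), y) := by
    filter_upwards [hslice.continuousAt.preimage_mem_nhds
      ((bundleChart EB EX e (π p) (e p).2).open_target.mem_nhds ht)] with y hy
    exact (hasFDerivAt_fibreRestriction_comp_chart_symm he hf (mem_chart_source _ _) hy).fderiv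
  have h2 : HasFDerivAt (fun y : EX ↦ (chartAt EB (π p) (π p), y)) (.inr ℝ EB EX)
      (chartAt EX (e p).2 (e p).2) := hasFDerivAt_prodMk_right _ _
  have h3 := (hG.comp _ h2).fderiv
  simp only [hessianAt, mfld_simps]
  rw [heq.fderiv_eq]
  exact h3

end Smooth

theorem isClosed_fibrewiseCriticalSet [IsManifold 𝓘(ℝ, EB) ∞ B] [IsManifold 𝓘(ℝ, EX) ∞ X]
    (hπ : IsSmoothFibreBundle EM EB EX X π) {f : M → ℝ} (hf : ContMDiff 𝓘(ℝ, EM) 𝓘(ℝ, ℝ) ∞ f) :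
    IsClosed (fibrewiseCriticalSet EM EB EX X π f) := by
  rw [← isOpen_compl_iff, isOpen_iff_eventually]
  intro p hp
  obtain ⟨e, hpe, he⟩ := hπ.2 (π p)
  set Φ := bundleChart EB EX e (π p) (e p).2
  have hps : p ∈ Φ.source :=
    mem_bundleChart_source.2 ⟨hpe, mem_chart_source _ _, mem_chart_source _ _⟩
  have hcont : ContinuousAt (fun q ↦ fibreDeriv EB EX e f (π p) (e p).2 (Φ q)) p :=
    ContinuousAt.comp (g := fibreDeriv EB EX e f (π p) (e p).2)
      ((contDiffOn_fibreDeriv he hf (π p) (e p).2).contDiffAt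
        (Φ.open_target.mem_nhds (Φ.map_source hps))).continuousAt (Φ.continuousAt hps)
  have hne := hcont.eventually_ne
    (mt (mem_fibrewiseCriticalSet_iff_fibreDeriv_eq_zero he hf hps).2 hp)
  filter_upwards [hne, Φ.open_source.mem_nhds hps] with q hq hqs
  exact mt (mem_fibrewiseCriticalSet_iff_fibreDeriv_eq_zero he hf hqs).1 hq

/-- Around a non-degenerate fibre-wise critical point, the fibre-wise critical set is the image of
a local section of the bundle. -/
theorem IsNondegenerateFibrewiseCriticalPoint.exists_local_section
    [FiniteDimensional ℝ EB] [FiniteDimensional ℝ EX]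
    [IsManifold 𝓘(ℝ, EB) ∞ B] [IsManifold 𝓘(ℝ, EX) ∞ X]
    {f : M → ℝ} (hf : ContMDiff 𝓘(ℝ, EM) 𝓘(ℝ, ℝ) ∞ f) {p : M}
    (hp : IsNondegenerateFibrewiseCriticalPoint EM EB EX X π f p) :
    ∃ g : B → M, Tendsto g (𝓝 (π p)) (𝓝 p) ∧
      (∀ᶠ b in 𝓝 (π p), g b ∈ fibrewiseCriticalSet EM EB EX X π f ∧ π (g b) = b) ∧
      ∀ᶠ q in 𝓝 p, q ∈ fibrewiseCriticalSet EM EB EX X π f → g (π q) = q := by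
  -- Working in the trivialization that witnesses non-degeneracy avoids comparing Hessians in
  -- different trivializations.
  obtain ⟨e, hpe, he, hcrit, hnd⟩ := hp
  have hps : p ∈ (bundleChart EB EX e (π p) (e p).2).source :=
    mem_bundleChart_source.2 ⟨hpe, mem_chart_source _ _, mem_chart_source _ _⟩
  rw [isCriticalPoint_fibreRestriction_iff_fibreDeriv_eq_zero he hf hps] at hcrit
  rw [hessianAt_fibreRestriction he hf hpe] at hnd
  have hG := ((contDiffOn_fibreDeriv he hf (π p) (e p).2).contDiffAt
    ((bundleChart EB EX e (π p) (e p).2).open_target.mem_nhds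
      ((bundleChart EB EX e (π p) (e p).2).map_source hps)))
  have hmem {q : M} := mem_fibrewiseCriticalSet_iff_fibreDeriv_eq_zero he hf
    (b := π p) (x := (e p).2) (q := q)
  set Φ := bundleChart EB EX e (π p) (e p).2 with hΦ
  set G := fibreDeriv EB EX e f (π p) (e p).2
  set c := chartAt EB (π p) with hc
  have hΦ1 {q : M} (hq : q ∈ Φ.source) : (Φ q).1 = c (π q) := by
    rw [hΦ, bundleChart_apply (mem_bundleChart_source.1 hq).1]
  have hG' : HasStrictFDerivAt G (fderiv ℝ G (Φ p)) (Φ p) := hG.hasStrictFDerivAt (by simp)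
  -- A non-singular Hessian is an injective map from `EX` to its dual, which has the same finite
  -- dimension.
  have hinv : ((fderiv ℝ G (Φ p)).comp (.inr ℝ EB EX)).IsInvertible := by
    set H := (fderiv ℝ G (Φ p)).comp (.inr ℝ EB EX)
    have hinj : Function.Injective H.toLinearMap := by
      rw [injective_iff_map_eq_zero]
      exact fun v hv ↦ hnd v fun w ↦ by
        have : H v = 0 := hv
        rw [this]; rfl
    have hdim : Module.finrank ℝ EX = Module.finrank ℝ (EX →L[ℝ] ℝ) := by
      rw [← (LinearMap.toContinuousLinearMap (𝕜 := ℝ) (E := EX) (F' := ℝ)).finrank_eq]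
      exact (Subspace.dual_finrank_eq).symm
    exact ⟨(LinearEquiv.ofInjectiveOfFinrankEq H.toLinearMap hinj hdim).toContinuousLinearEquiv,
      by ext; rfl⟩
  set ψ := hG'.implicitFunctionOfProdDomain hinv
  have hψt : Tendsto ψ (𝓝 (c (π p))) (𝓝 (Φ p).2) := by
    have := hG'.tendsto_implicitFunctionOfProdDomain hinv
    rwa [hΦ1 hps] at this
  have hct : Tendsto c (𝓝 (π p)) (𝓝 (c (π p))) := c.continuousAt (mem_chart_source _ _)
  have hσ : Tendsto (fun b ↦ (c b, ψ (c b))) (𝓝 (π p)) (𝓝 (Φ p)) := by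
    have := hct.prodMk_nhds (hψt.comp hct)
    rwa [← hΦ1 hps] at this
  refine ⟨fun b ↦ Φ.symm (c b, ψ (c b)), ?_, ?_, ?_⟩
  · have := (Φ.symm.continuousAt (Φ.map_source hps)).tendsto.comp hσ
    rwa [Φ.left_inv hps] at this
  · have hzero := hct.eventually <| hΦ1 hps ▸
      hG'.eventually_apply_implicitFunctionOfProdDomain hinv
    filter_upwards [hzero, hσ (Φ.open_target.mem_nhds (Φ.map_source hps)),
      (chart_source_mem_nhds EB (π p))] with b hb hbt hbs
    refine ⟨(hmem (Φ.map_target hbt)).2 ?_, ?_⟩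
    · rw [Φ.right_inv hbt, hb, hcrit]
    · rw [hΦ, proj_bundleChart_symm hbt]
      exact c.left_inv hbs
  -- Local uniqueness of the implicit function: zeros of `G` near `Φ p` lie on the graph of `ψ`.
  · have hiff := (Φ.continuousAt hps).eventually
      (hG'.eventually_apply_eq_iff_implicitFunctionOfProdDomain hinv)
    filter_upwards [hiff, Φ.open_source.mem_nhds hps] with q hq hqs hqN
    have h1 := hq.1 (((hmem hqs).1 hqN).trans hcrit.symm)
    have h2 : (c (π q), ψ (c (π q))) = Φ q := by
      rw [← hΦ1 hqs]
      exact Prod.ext rfl h1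
    rw [h2, Φ.left_inv hqs]

end FibreBundle

/-! ### Conclusion -/

theorem mainTheorem4
    {EM EB EX : Type*}
    [NormedAddCommGroup EM] [NormedSpace ℝ EM] [FiniteDimensional ℝ EM]
    [NormedAddCommGroup EB] [NormedSpace ℝ EB] [FiniteDimensional ℝ EB]
    [NormedAddCommGroup EX] [NormedSpace ℝ EX] [FiniteDimensional ℝ EX]
    {M Θ X : Type*}
    [TopologicalSpace M] [ChartedSpace EM M] [IsManifold 𝓘(ℝ, EM) ∞ M]
    [T2Space M] [CompactSpace M]
    [TopologicalSpace Θ] [ChartedSpace EB Θ] [IsManifold 𝓘(ℝ, EB) ∞ Θ]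
    [T2Space Θ] [CompactSpace Θ] [PreconnectedSpace Θ]
    [TopologicalSpace X] [ChartedSpace EX X] [IsManifold 𝓘(ℝ, EX) ∞ X]
    [T2Space X] [CompactSpace X]
    (π : M → Θ) (hπ : IsSmoothFibreBundle EM EB EX X π)
    (f : M → ℝ) (hf : ContMDiff 𝓘(ℝ, EM) 𝓘(ℝ, ℝ) ∞ f)
    (hMorse : IsFibrewiseMorse EM EB EX X π f) :
    ∃ n : ℕ, ∀ θ : Θ, (fibrewiseCriticalSet EM EB EX X π f ∩ π ⁻¹' {θ}).encard = n := by
  have hcpt : CompactSpace (fibrewiseCriticalSet EM EB EX X π f) :=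
    isCompact_iff_compactSpace.1 (isClosed_fibrewiseCriticalSet hπ hf).isCompact
  have hloc := isLocalHomeomorph_domRestrict_of_local_section
    (N := fibrewiseCriticalSet EM EB EX X π f) hπ.1.continuous
    fun p hp ↦ (hMorse p hp).exists_local_section hf
  have hcov : IsCoveringMap ((fibrewiseCriticalSet EM EB EX X π f).domRestrict π) :=
    isLocalHomeomorph_iff_isCoveringMap.1 hloc
  obtain ⟨n, hn⟩ := hcov.exists_encard_preimage_singleton_eq
  refine ⟨n, fun θ ↦ ?_⟩
  -- The covering's fibre lives in the subtype `N`; its injective image in `M` is `N ∩ π ⁻¹' {θ}`.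
  rw [← hn θ, ← Subtype.val_injective.encard_image]
  congr 1
  ext q
  simp [and_comm]
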